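/- Let $G$ be a complete bipartite graph with finite nonempty parts $\{x_1,\ldots,x_n\}$ and $\{y_1,\ldots,y_m\}$, let $\mathbb{k}$ be a field, and let $R=\mathbb{k}[x_1,\ldots,x_n,y_1,\ldots,y_m]$ be the standard graded polynomial ring. Let $I=I(G)=(x_iy_j \mid 1\le i\le n,\ 1\le j\le m)\subset R$ be the edge ideal of $G$. For a nonzero homogeneous ideal $J\subset R$ with minimal graded free resolution $\cdots\to F_1\to F_0\to J\to 0$, $F_i=\bigoplus_j R(-b_{ij})$, let $\operatorname{reg}(J)=\max_{i,j}\{b_{ij}-i\}$ denote its Castelnuovo–Mumford regularity. Then for every integer $s\ge 1$ we have $\operatorname{reg}(I^s)=2s$, and $I^s$ has a linear resolution, that is, $b_{ij}=2s+i$ for all $i,j$ in the minimal graded free resolution of $I^s$. -/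

import Mathlib

open MvPolynomial

noncomputable section

namespace EdgeIdealPowers

/-- The edge ideal of a simple graph on the vertex set `V`, over the field `𝕜`: the ideal of the
polynomial ring `𝕜[V]` generated by the monomials `u v` with `u` adjacent to `v`. -/
def edgeIdeal {V : Type*} (𝕜 : Type*) [Field 𝕜] (G : SimpleGraph V) : Ideal (MvPolynomial V 𝕜) :=
  Ideal.span {f | ∃ u v : V, G.Adj u v ∧ f = X u * X v}

/-- The graded piece of degree `j : ℤ` of the standard graded polynomial ring `𝕜[V]`;
it is zero for `j < 0`. -/
def degreePart (V 𝕜 : Type*) [Field 𝕜] : ℤ → Submodule 𝕜 (MvPolynomial V 𝕜)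
  | Int.ofNat n => homogeneousSubmodule V 𝕜 n
  | Int.negSucc _ => ⊥

/-- A minimal graded free resolution `⋯ → F₂ → F₁ → F₀ → J → 0` of an ideal `J` of the standard
graded polynomial ring `R = 𝕜[V]`, where `F i = ⨁ₖ R(-shift i k)` is a finitely generated graded
free module. Its `k`-th standard basis vector has degree `shift i k`, so an element `f` of `F i` is
homogeneous of degree `j` when each coordinate `f k` lies in `R` in degree `j - shift i k`. -/
structure MinimalGradedFreeResolution {V 𝕜 : Type*} [Field 𝕜] (J : Ideal (MvPolynomial V 𝕜)) where
  /-- the rank of `F i` -/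
  rank : ℕ → ℕ
  /-- the degrees of the basis elements of `F i` -/
  shift : (i : ℕ) → Fin (rank i) → ℤ
  /-- the augmentation `F 0 → J ⊆ R` -/
  aug : (Fin (rank 0) → MvPolynomial V 𝕜) →ₗ[MvPolynomial V 𝕜] MvPolynomial V 𝕜
  /-- the differential `F (i + 1) → F i` -/
  diff : (i : ℕ) → (Fin (rank (i + 1)) → MvPolynomial V 𝕜) →ₗ[MvPolynomial V 𝕜]
    (Fin (rank i) → MvPolynomial V 𝕜)
  /-- the augmentation preserves degrees -/
  aug_graded : ∀ k, aug (Pi.single k 1) ∈ degreePart V 𝕜 (shift 0 k)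
  /-- the differentials preserve degrees -/
  diff_graded : ∀ i l k,
    diff i (Pi.single l 1) k ∈ degreePart V 𝕜 (shift (i + 1) l - shift i k)
  /-- exactness at `J` -/
  range_aug : LinearMap.range aug = J
  /-- exactness at `F 0` -/
  exact_zero : Function.Exact (diff 0) aug
  /-- exactness at `F (i + 1)` -/
  exact_succ : ∀ i, Function.Exact (diff (i + 1)) (diff i)
  /-- minimality: the matrices of the differentials have entries in the ideal generated by the
  variables, that is, the image of `F (i + 1)` lies in `𝔪 F i` -/
  minimal : ∀ i l k, diff i (Pi.single l 1) k ∈ Ideal.span (Set.range (X : V → MvPolynomial V 𝕜))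

/-- The Castelnuovo–Mumford regularity of a homogeneous ideal `J`: the supremum of all `j - i` such
that `R(-j)` occurs as a direct summand of `F i` in a minimal graded free resolution of `J` (which
is unique up to isomorphism). It is `⊥` (that is, `-∞`) for the zero ideal. An integer value is a
maximum. -/
def regularity {V 𝕜 : Type*} [Field 𝕜] (J : Ideal (MvPolynomial V 𝕜)) : WithBot (WithTop ℤ) :=
  ⨆ (F : MinimalGradedFreeResolution J) (i : ℕ) (k : Fin (F.rank i)),
    (((F.shift i k - (i : ℤ) : ℤ) : WithTop ℤ) : WithBot (WithTop ℤ))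

/-- `J` has a `d`-linear resolution: it has a minimal graded free resolution in which `F i` is
a direct sum of copies of `R(-(d + i))`, for all `i`. -/
def HasLinearResolution {V 𝕜 : Type*} [Field 𝕜] (J : Ideal (MvPolynomial V 𝕜)) (d : ℤ) : Prop :=
  ∃ F : MinimalGradedFreeResolution J, ∀ (i : ℕ) (k : Fin (F.rank i)), F.shift i k = d + (i : ℤ)

end EdgeIdealPowers

end

/-! For a complete bipartite graph, I^s = (x)^s (y)^s is spanned by the monomials of degree at least
s in each block of variables (`edgeIdeal_pow_eq`). Linearity is proved for all products (A)^s (B)^t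
with A, B disjoint, adding one variable a at a time: (A,a)^(s+1) (B)^t = J + aJ', where J =
(A)^(s+1) (B)^t lies in J' = (A,a)^s (B)^t. Since a is a nonzerodivisor modulo J, J ∩ aJ' = aJ, so 0
→ J(-1) → J ⊕ J'(-1) → J + aJ' → 0 is exact, and the mapping cone of linear resolutions is again
linear (`exists_isLinear_sup`).

The regularity is a supremum over all minimal resolutions, so each must be compared with the linear
one (`deg_le_of_isLinear`). The identity of a minimal resolution is homotopic to a map factoring
through the linear resolution. Modulo the variables the homotopy terms vanish, and a basis element
of too large a degree would give 1 = 0. The linear resolution itself attains the bound.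

Matrices act on row vectors. Resolutions are augmented by the ring at level 0, so lifting an
inclusion of ideals starts from the identity of the ring. -/

open MvPolynomial

noncomputable section

namespace EdgeIdealPowers

/-! ### Integer-graded pieces and homogeneous solutions of graded linear systems. -/

section Degree

variable {V 𝕜 : Type*} [Field 𝕜]

/-- For negative e no exponent satisfies the condition, which forces f = 0; the sign of e can then
be ignored. -/
lemma mem_degreePart_iff {e : ℤ} {f : MvPolynomial V 𝕜} :
    f ∈ degreePart V 𝕜 e ↔ ∀ u, coeff u f ≠ 0 → (u.degree : ℤ) = e := by
  cases e with
  | ofNat n =>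
    simp only [degreePart, mem_homogeneousSubmodule, IsHomogeneous, IsWeightedHomogeneous,
      Finsupp.degree_eq_weight_one]
    simp only [Int.ofNat_eq_natCast, Nat.cast_inj, Pi.one_def]
  | negSucc n =>
    simp only [degreePart, Submodule.mem_bot]
    constructor
    · rintro rfl u hu
      simp at hu
    · intro h
      ext u
      by_contra hu
      have := h u hu
      omega

/-- The component of degree `e : ℤ` of a polynomial. -/
def degreeComponent : ℤ → MvPolynomial V 𝕜 →ₗ[𝕜] MvPolynomial V 𝕜
  | Int.ofNat n => homogeneousComponent n
  | Int.negSucc _ => 0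

lemma coeff_degreeComponent (e : ℤ) (f : MvPolynomial V 𝕜) (u : V →₀ ℕ) :
    coeff u (degreeComponent e f) = if (u.degree : ℤ) = e then coeff u f else 0 := by
  cases e with
  | ofNat n =>
    simp only [degreeComponent, coeff_homogeneousComponent, Int.ofNat_eq_natCast, Nat.cast_inj]
  | negSucc n =>
    rw [if_neg (by omega)]
    simp [degreeComponent]

lemma degreeComponent_mem (e : ℤ) (f : MvPolynomial V 𝕜) :
    degreeComponent e f ∈ degreePart V 𝕜 e := by
  rw [mem_degreePart_iff]
  intro u hu
  by_contra h
  rw [coeff_degreeComponent, if_neg h] at hu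
  exact hu rfl

lemma degreeComponent_of_mem {e : ℤ} {f : MvPolynomial V 𝕜} (hf : f ∈ degreePart V 𝕜 e) :
    degreeComponent e f = f := by
  rw [mem_degreePart_iff] at hf
  ext u
  rw [coeff_degreeComponent]
  split_ifs with h
  · rfl
  · by_contra h'
    exact h (hf u (Ne.symm h'))

/-- Every exponent of g has degree b, so a term of the product has degree e + b exactly when its
factor from f has degree e. -/
lemma degreeComponent_mul {b : ℤ} {g : MvPolynomial V 𝕜} (hg : g ∈ degreePart V 𝕜 b) (e : ℤ)
    (f : MvPolynomial V 𝕜) :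
    degreeComponent (e + b) (f * g) = degreeComponent e f * g := by
  classical
  rw [mem_degreePart_iff] at hg
  ext u
  rw [coeff_degreeComponent, coeff_mul, coeff_mul]
  have key : ∀ p ∈ Finset.HasAntidiagonal.antidiagonal u, coeff p.1 (degreeComponent e f) * coeff p.2 g =
      if (u.degree : ℤ) = e + b then coeff p.1 f * coeff p.2 g else 0 := by
    intro p hp
    rw [coeff_degreeComponent]
    by_cases h0 : coeff p.2 g = 0
    · simp [h0]
    · have h1 := hg _ h0
      have h2 : (p.1.degree : ℤ) + p.2.degree = u.degree := by
        rw [← Finset.HasAntidiagonal.mem_antidiagonal.mp hp, map_add]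
        push_cast
        rfl
      have h3 : (p.1.degree : ℤ) = e ↔ (u.degree : ℤ) = e + b := by
        constructor <;> intro h <;> linarith
      simp only [h3]
      split_ifs <;> simp
  rw [Finset.sum_congr rfl key]
  split_ifs <;> simp

lemma mul_mem_degreePart {a b : ℤ} {f g : MvPolynomial V 𝕜} (hf : f ∈ degreePart V 𝕜 a)
    (hg : g ∈ degreePart V 𝕜 b) : f * g ∈ degreePart V 𝕜 (a + b) := by
  rw [← degreeComponent_of_mem hf, ← degreeComponent_mul hg]
  exact degreeComponent_mem _ _

lemma one_mem_degreePart : (1 : MvPolynomial V 𝕜) ∈ degreePart V 𝕜 0 :=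
  isHomogeneous_one V 𝕜

lemma X_mem_degreePart (a : V) : (X a : MvPolynomial V 𝕜) ∈ degreePart V 𝕜 1 :=
  isHomogeneous_X 𝕜 a

lemma constantCoeff_eq_zero_of_mem_degreePart {e : ℤ} (he : e ≠ 0) {f : MvPolynomial V 𝕜}
    (hf : f ∈ degreePart V 𝕜 e) : constantCoeff f = 0 := by
  rw [mem_degreePart_iff] at hf
  by_contra h
  have := hf 0 h
  simp at this
  exact he this.symm

/-- A solution of a graded linear system with homogeneous right-hand side may be taken to be
homogeneous. -/
lemma exists_homogeneous_vecMul_eq {m n : Type*} [Fintype m] {M : Matrix m n (MvPolynomial V 𝕜)}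
    {p : m → ℤ} {q : n → ℤ} (hM : ∀ l k, M l k ∈ degreePart V 𝕜 (p l - q k)) {e : ℤ}
    {v : n → MvPolynomial V 𝕜} (hv : ∀ k, v k ∈ degreePart V 𝕜 (e - q k))
    (h : ∃ w, Matrix.vecMul w M = v) :
    ∃ w, Matrix.vecMul w M = v ∧ ∀ l, w l ∈ degreePart V 𝕜 (e - p l) := by
  obtain ⟨w, rfl⟩ := h
  refine ⟨fun l => degreeComponent (e - p l) (w l), ?_, fun l => degreeComponent_mem _ _⟩
  ext1 k
  rw [← degreeComponent_of_mem (hv k)]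
  simp only [Matrix.vecMul, dotProduct, map_sum]
  refine Finset.sum_congr rfl fun l _ => ?_
  rw [← degreeComponent_mul (hM l k)]
  congr 2
  ring

end Degree

/-! ### Augmented graded resolutions in matrix form. -/

/-- A graded free resolution of an ideal by free modules with chosen bases, in matrix form.
Level `0` is the polynomial ring itself, and level `i + 1` is the `i`-th free module. -/
structure GradedResolution (V 𝕜 : Type*) [Field 𝕜] where
  ι : ℕ → Type
  [fintype : ∀ i, Fintype (ι i)]
  [decEq : ∀ i, DecidableEq (ι i)]
  [unique : Unique (ι 0)]
  deg : ∀ i, ι i → ℤ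
  deg_zero : ∀ k, deg 0 k = 0
  d : ∀ i, Matrix (ι (i + 1)) (ι i) (MvPolynomial V 𝕜)
  graded : ∀ i l k, d i l k ∈ degreePart V 𝕜 (deg (i + 1) l - deg i k)
  comp : ∀ i, d (i + 1) * d i = 0
  exact : ∀ i v, Matrix.vecMul v (d i) = 0 → ∃ w, Matrix.vecMul w (d (i + 1)) = v

attribute [instance] GradedResolution.fintype GradedResolution.decEq GradedResolution.unique

/-- Dependent choice with varying types. `Good` is the invariant that makes the next step possible;
it serves to build both chain maps and homotopies. -/
lemma exists_dependent_seq {T : ℕ → Type*} (Good : ∀ i, T i → Prop)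
    (Rel : ∀ i, T i → T (i + 1) → Prop) (x₀ : T 0) (h₀ : Good 0 x₀)
    (step : ∀ i x, Good i x → ∃ y, Good (i + 1) y ∧ Rel i x y) :
    ∃ x : ∀ i, T i, x 0 = x₀ ∧ (∀ i, Good i (x i)) ∧ ∀ i, Rel i (x i) (x (i + 1)) := by
  choose next hgood hrel using step
  let s : ∀ i, {x : T i // Good i x} := fun i =>
    Nat.rec ⟨x₀, h₀⟩ (fun i x => ⟨next i x.1 x.2, hgood i x.1 x.2⟩) i
  exact ⟨fun i => (s i).1, rfl, fun i => (s i).2, fun i => hrel i (s i).1 (s i).2⟩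

/-! ### Comparison of resolutions: lifting, homotopy, and the degree bound. -/

namespace GradedResolution

variable {V 𝕜 : Type*} [Field 𝕜]

/-- `F` resolves the ideal `J`: the entries of the first matrix generate `J`. -/
def Resolves (F : GradedResolution V 𝕜) (J : Ideal (MvPolynomial V 𝕜)) : Prop :=
  ∀ f, f ∈ J ↔ ∃ v, Matrix.vecMul v (F.d 0) = fun _ => f

/-- `F` is linear with generators in degree `e`. -/
def IsLinear (F : GradedResolution V 𝕜) (e : ℤ) : Prop :=
  ∀ i k, F.deg (i + 1) k = e + i

lemma Resolves.entry_mem {F : GradedResolution V 𝕜} {J : Ideal (MvPolynomial V 𝕜)}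
    (hF : F.Resolves J) (l : F.ι 1) (k : F.ι 0) : F.d 0 l k ∈ J := by
  rw [hF]
  refine ⟨Pi.single l 1, ?_⟩
  ext1 k'
  rw [Matrix.single_one_vecMul, Subsingleton.elim k k']
  rfl

/-- An inclusion of resolved ideals lifts to a graded chain map. -/
theorem exists_chainMap (F G : GradedResolution V 𝕜) {J J' : Ideal (MvPolynomial V 𝕜)}
    (hF : F.Resolves J) (hG : G.Resolves J') (hJ : J ≤ J') :
    ∃ φ : ∀ i, Matrix (F.ι i) (G.ι i) (MvPolynomial V 𝕜), φ 0 = (Matrix.of fun _ _ => 1) ∧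
      (∀ i l k, φ i l k ∈ degreePart V 𝕜 (F.deg i l - G.deg i k)) ∧
      ∀ i, F.d i * φ i = φ (i + 1) * G.d i := by
  -- Besides degrees, the invariant records that the rows of `F.d i * φ` lie in the image of `G.d
  -- i`; this is what allows the next lift.
  refine (exists_dependent_seq
    (T := fun i => Matrix (F.ι i) (G.ι i) (MvPolynomial V 𝕜))
    (fun i φ => (∀ l k, φ l k ∈ degreePart V 𝕜 (F.deg i l - G.deg i k)) ∧
      ∀ l, ∃ w, Matrix.vecMul w (G.d i) = (F.d i * φ) l)
    (fun i φ ψ => F.d i * φ = ψ * G.d i) (Matrix.of fun _ _ => 1) ?_ ?_).imp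
      fun φ h => ⟨h.1, fun i => (h.2.1 i).1, h.2.2⟩
  · constructor
    · intro l k
      rw [F.deg_zero, G.deg_zero, sub_zero]
      exact one_mem_degreePart
    · intro l
      obtain ⟨w, hw⟩ := (hG _).1 (hJ (hF.entry_mem l default))
      refine ⟨w, ?_⟩
      rw [hw]
      ext1 k
      simp [Matrix.mul_apply]
  · rintro i φ ⟨hφ, hw⟩
    have hdeg : ∀ l k, (F.d i * φ) l k ∈ degreePart V 𝕜 (F.deg (i + 1) l - G.deg i k) := by
      intro l k
      rw [Matrix.mul_apply]
      refine Submodule.sum_mem _ fun j _ => ?_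
      have := mul_mem_degreePart (F.graded i l j) (hφ j k)
      rwa [sub_add_sub_cancel] at this
    choose ψ hψ hψdeg using fun l =>
      exists_homogeneous_vecMul_eq (G.graded i) (hdeg l) (hw l)
    have hrel : F.d i * φ = Matrix.of ψ * G.d i := by
      funext l
      exact (hψ l).symm
    refine ⟨Matrix.of ψ, ⟨hψdeg, fun l => G.exact i _ ?_⟩, hrel⟩
    change Matrix.vecMul ((F.d (i + 1) * Matrix.of ψ) l) (G.d i) = 0
    have : (F.d (i + 1) * Matrix.of ψ) * G.d i = 0 := by
      rw [Matrix.mul_assoc, ← hrel, ← Matrix.mul_assoc, F.comp, Matrix.zero_mul]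
    exact congrFun this l

/-- A chain endomorphism which is zero at level `0` is null-homotopic. -/
theorem exists_homotopy (G : GradedResolution V 𝕜)
    (ψ : ∀ i, Matrix (G.ι i) (G.ι i) (MvPolynomial V 𝕜)) (h0 : ψ 0 = 0)
    (hψ : ∀ i, G.d i * ψ i = ψ (i + 1) * G.d i) :
    ∃ h : ∀ i, Matrix (G.ι i) (G.ι (i + 1)) (MvPolynomial V 𝕜), h 0 = 0 ∧
      ∀ i, ψ (i + 1) = G.d i * h i + h (i + 1) * G.d (i + 1) := by
  -- The invariant says that the rows of `ψ (i + 1) - G.d i * h` are cycles, hence boundaries by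
  -- exactness. The start h = 0 is admissible because `ψ 0 = 0`.
  refine (exists_dependent_seq
    (T := fun i => Matrix (G.ι i) (G.ι (i + 1)) (MvPolynomial V 𝕜))
    (fun i h => (ψ (i + 1) - G.d i * h) * G.d i = 0)
    (fun i h h' => ψ (i + 1) = G.d i * h + h' * G.d (i + 1)) 0 ?_ ?_).imp
      fun h hh => ⟨hh.1, hh.2.2⟩
  · rw [Matrix.mul_zero, sub_zero, ← hψ, h0, Matrix.mul_zero]
  · intro i h hh
    choose h' hh' using fun l => G.exact i ((ψ (i + 1) - G.d i * h) l) (congrFun hh l)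
    have hrel : ψ (i + 1) - G.d i * h = Matrix.of h' * G.d (i + 1) := by
      funext l
      exact (hh' l).symm
    refine ⟨Matrix.of h', ?_, by rw [← hrel]; abel⟩
    rw [Matrix.sub_mul, ← hψ, Matrix.mul_assoc, ← hrel, Matrix.mul_sub, sub_sub_cancel,
      ← Matrix.mul_assoc, G.comp, Matrix.zero_mul]

/-- In a minimal graded resolution of an ideal that has a linear resolution, all basis elements
have at most the expected degree. -/
theorem deg_le_of_isLinear {F G : GradedResolution V 𝕜} {J : Ideal (MvPolynomial V 𝕜)}
    (hF : F.Resolves J) (hG : G.Resolves J) {e : ℤ} (hlin : F.IsLinear e)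
    (hmin : ∀ i l k, constantCoeff (G.d (i + 1) l k) = 0) (i : ℕ) (k : G.ι (i + 1)) :
    G.deg (i + 1) k ≤ e + i := by
  by_contra! hlt
  obtain ⟨α, hα0, hα, hαd⟩ := exists_chainMap G F hG hF le_rfl
  obtain ⟨β, hβ0, -, hβd⟩ := exists_chainMap F G hF hG le_rfl
  obtain ⟨h, h0, hh⟩ := exists_homotopy G (fun i => 1 - α i * β i) (by
      ext1 a b
      rw [Matrix.sub_apply, Matrix.mul_apply, Subsingleton.elim a b]
      simp [hα0, hβ0])
    (fun i => by
      rw [Matrix.mul_sub, Matrix.sub_mul, ← Matrix.mul_assoc, hαd, Matrix.mul_assoc, hβd,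
        Matrix.mul_one, Matrix.one_mul, Matrix.mul_assoc])
  -- Constant terms of the diagonal entry at k: the identity contributes 1, and everything else will
  -- vanish.
  have hk := congrArg constantCoeff (congrFun (congrFun (hh i) k) k)
  simp only [Matrix.sub_apply, Matrix.add_apply, Matrix.one_apply_eq, Matrix.mul_apply, map_sub,
    map_add, map_one, map_sum, map_mul, hmin, mul_zero, Finset.sum_const_zero, add_zero] at hk
  -- These entries have degree `G.deg (i + 1) k - (e + i)`, which is positive by `hlt`.
  have h1 : ∀ l, constantCoeff (α (i + 1) k l) = 0 := fun l =>
    constantCoeff_eq_zero_of_mem_degreePart (by rw [hlin]; omega) (hα _ k l)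
  -- Minimality says nothing about the augmentation `G.d 0`; at i = 0 the vanishing of `h 0` takes
  -- its place.
  have h2 : ∀ j, constantCoeff (G.d i k j) * constantCoeff (h i j k) = 0 := by
    intro j
    cases i with
    | zero => simp [h0]
    | succ i => simp [hmin]
  simp [h1, h2] at hk

end GradedResolution

/-! ### The mapping cone and the resolution of J + aJ'. -/

namespace GradedResolution

variable {V 𝕜 : Type*} [Field 𝕜]

/-- The basis of the free module before level `i + 1`, truncated so that nothing comes from the
polynomial ring at level `0`. -/
abbrev prev (F : GradedResolution V 𝕜) : ℕ → Type
  | 0 => Empty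
  | i + 1 => F.ι (i + 1)

instance (F : GradedResolution V 𝕜) : ∀ i, Fintype (F.prev i)
  | 0 => inferInstanceAs (Fintype Empty)
  | i + 1 => F.fintype (i + 1)

instance (F : GradedResolution V 𝕜) : ∀ i, DecidableEq (F.prev i)
  | 0 => inferInstanceAs (DecidableEq Empty)
  | i + 1 => F.decEq (i + 1)

/-- The degrees of the basis `F.prev i`. -/
def prevDeg (F : GradedResolution V 𝕜) : ∀ i, F.prev i → ℤ
  | 0 => Empty.elim
  | i + 1 => F.deg (i + 1)

/-- The truncated differential. -/
def prevD (F : GradedResolution V 𝕜) :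
    ∀ i, Matrix (F.ι (i + 1)) (F.prev i) (MvPolynomial V 𝕜)
  | 0 => 0
  | i + 1 => F.d (i + 1)

lemma prevD_graded (F : GradedResolution V 𝕜) :
    ∀ i l k, F.prevD i l k ∈ degreePart V 𝕜 (F.deg (i + 1) l - F.prevDeg i k)
  | 0, _, k => k.elim
  | i + 1, l, k => F.graded (i + 1) l k

lemma d_mul_prevD (F : GradedResolution V 𝕜) : ∀ i, F.d (i + 1) * F.prevD i = 0
  | 0 => Matrix.mul_zero _
  | i + 1 => F.comp (i + 1)

/-- The bases of the mapping cone of `F(-1) → F ⊕ G(-1)`. -/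
abbrev coneι (F G : GradedResolution V 𝕜) : ℕ → Type
  | 0 => Unit
  | i + 1 => (F.ι (i + 1) ⊕ G.ι (i + 1)) ⊕ F.prev i

instance (F G : GradedResolution V 𝕜) : ∀ i, Fintype (coneι F G i)
  | 0 => inferInstanceAs (Fintype Unit)
  | i + 1 => inferInstanceAs (Fintype ((F.ι (i + 1) ⊕ G.ι (i + 1)) ⊕ F.prev i))

instance (F G : GradedResolution V 𝕜) : ∀ i, DecidableEq (coneι F G i)
  | 0 => inferInstanceAs (DecidableEq Unit)
  | i + 1 => inferInstanceAs (DecidableEq ((F.ι (i + 1) ⊕ G.ι (i + 1)) ⊕ F.prev i))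

instance (F G : GradedResolution V 𝕜) : Unique (coneι F G 0) :=
  inferInstanceAs (Unique Unit)

/-- The degrees of the basis elements of the mapping cone. -/
def coneDeg (F G : GradedResolution V 𝕜) : ∀ i, coneι F G i → ℤ
  | 0 => fun _ => 0
  | i + 1 => Sum.elim (Sum.elim (F.deg (i + 1)) fun k => G.deg (i + 1) k + 1)
      fun k => F.prevDeg i k + 1

/-- The differential of the mapping cone of `(a, -φ) : F(-1) → F ⊕ G(-1)`. -/
def coneD (F G : GradedResolution V 𝕜) (a : MvPolynomial V 𝕜)
    (φ : ∀ i, Matrix (F.ι i) (G.ι i) (MvPolynomial V 𝕜)) :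
    ∀ i, Matrix (coneι F G (i + 1)) (coneι F G i) (MvPolynomial V 𝕜)
  | 0 => Matrix.of fun x _ =>
      Sum.elim (Sum.elim (fun l => F.d 0 l default) fun l => a * G.d 0 l default) Empty.elim x
  | i + 1 => Matrix.fromBlocks (Matrix.fromBlocks (F.d (i + 1)) 0 0 (G.d (i + 1))) 0
      (Matrix.fromCols (a • (1 : Matrix (F.ι (i + 1)) (F.ι (i + 1)) (MvPolynomial V 𝕜)))
        (-φ (i + 1))) (-F.prevD i)

section Cone

variable {F G : GradedResolution V 𝕜} {a : MvPolynomial V 𝕜}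
  {φ : ∀ i, Matrix (F.ι i) (G.ι i) (MvPolynomial V 𝕜)}

lemma vecMul_coneD_zero (x : F.ι 1 → MvPolynomial V 𝕜) (y : G.ι 1 → MvPolynomial V 𝕜)
    (z : F.prev 0 → MvPolynomial V 𝕜) :
    Matrix.vecMul (Sum.elim (Sum.elim x y) z : coneι F G 1 → MvPolynomial V 𝕜)
      (coneD F G a φ 0) =
      fun _ => Matrix.vecMul x (F.d 0) default + a * Matrix.vecMul y (G.d 0) default := by
  funext u
  change ∑ t : (F.ι 1 ⊕ G.ι 1) ⊕ Empty, _ = _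
  simp [Matrix.vecMul, dotProduct, coneD, Finset.mul_sum, mul_left_comm]

lemma vecMul_coneD_succ (i : ℕ) (x : F.ι (i + 2) → MvPolynomial V 𝕜)
    (y : G.ι (i + 2) → MvPolynomial V 𝕜) (z : F.ι (i + 1) → MvPolynomial V 𝕜) :
    Matrix.vecMul (Sum.elim (Sum.elim x y) z : coneι F G (i + 2) → MvPolynomial V 𝕜)
      (coneD F G a φ (i + 1)) =
      (Sum.elim (Sum.elim (Matrix.vecMul x (F.d (i + 1)) + a • z)
        (Matrix.vecMul y (G.d (i + 1)) - Matrix.vecMul z (φ (i + 1))))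
        (-Matrix.vecMul z (F.prevD i)) : coneι F G (i + 1) → MvPolynomial V 𝕜) := by
  refine (Matrix.vecMul_fromBlocks _ _ _ _ _).trans ?_
  congr 1
  · funext t
    cases t <;>
    simp [Matrix.vecMul_fromBlocks, Matrix.vecMul_neg, Matrix.vecMul_smul, sub_eq_add_neg]
  · simp [Matrix.vecMul_neg]

lemma exists_sum_elim {α β γ δ : Type*} (v : (α ⊕ β) ⊕ γ → δ) :
    ∃ x y z, v = Sum.elim (Sum.elim x y) z :=
  ⟨fun l => v (.inl (.inl l)), fun l => v (.inl (.inr l)), fun l => v (.inr l), by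
    funext t; rcases t with (t | t) | t <;> rfl⟩

lemma coneD_graded (ha : a ∈ degreePart V 𝕜 1)
    (hφ : ∀ i l k, φ i l k ∈ degreePart V 𝕜 (F.deg i l - G.deg i k)) :
    ∀ i l k, coneD F G a φ i l k ∈ degreePart V 𝕜 (coneDeg F G (i + 1) l - coneDeg F G i k) := by
  intro i l k
  cases i with
  | zero =>
    rcases l with (l | l) | l
    · have := F.graded 0 l default
      rw [F.deg_zero] at this
      exact this
    · have := mul_mem_degreePart ha (G.graded 0 l default)
      rw [G.deg_zero, sub_zero, add_comm] at this
      change _ ∈ degreePart V 𝕜 (G.deg 1 l + 1 - 0)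
      rw [sub_zero]
      exact this
    · exact l.elim
  | succ i =>
    rcases l with (l | l) | l <;> rcases k with (k | k) | k
    · exact F.graded (i + 1) l k
    · exact Submodule.zero_mem _
    · exact Submodule.zero_mem _
    · exact Submodule.zero_mem _
    · change G.d (i + 1) l k ∈ degreePart V 𝕜 (G.deg (i + 2) l + 1 - (G.deg (i + 1) k + 1))
      rw [add_sub_add_right_eq_sub]
      exact G.graded (i + 1) l k
    · exact Submodule.zero_mem _
    · change a * (1 : Matrix (F.ι (i + 1)) (F.ι (i + 1)) (MvPolynomial V 𝕜)) l k ∈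
        degreePart V 𝕜 (F.deg (i + 1) l + 1 - F.deg (i + 1) k)
      rw [Matrix.one_apply]
      split_ifs with h
      · subst h
        rw [mul_one, add_sub_cancel_left]
        exact ha
      · rw [mul_zero]
        exact Submodule.zero_mem _
    · change -φ (i + 1) l k ∈ degreePart V 𝕜 (F.deg (i + 1) l + 1 - (G.deg (i + 1) k + 1))
      rw [add_sub_add_right_eq_sub]
      exact Submodule.neg_mem _ (hφ _ l k)
    · change -F.prevD i l k ∈ degreePart V 𝕜 (F.deg (i + 1) l + 1 - (F.prevDeg i k + 1))
      rw [add_sub_add_right_eq_sub]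
      exact Submodule.neg_mem _ (F.prevD_graded i l k)

lemma mul_eq_zero_of_vecMul {R l m n : Type*} [CommRing R] [Fintype l] [DecidableEq l] [Fintype m]
    {M : Matrix l m R} {N : Matrix m n R}
    (h : ∀ v, Matrix.vecMul (Matrix.vecMul v M) N = 0) : M * N = 0 := by
  ext i j
  have := congrFun (h (Pi.single i 1)) j
  rw [Matrix.vecMul_vecMul, Matrix.single_one_vecMul] at this
  exact this

/-- At the lowest level the two images of z, through a and through φ, cancel because φ is the
identity on the ring. Higher up the chain map relation gives the cancellation. -/
lemma coneD_comp (hφ0 : φ 0 = Matrix.of fun _ _ => 1)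
    (hφd : ∀ i, F.d i * φ i = φ (i + 1) * G.d i) (i : ℕ) :
    coneD F G a φ (i + 1) * coneD F G a φ i = 0 := by
  refine mul_eq_zero_of_vecMul fun v => ?_
  obtain ⟨x, y, z, rfl⟩ := exists_sum_elim v
  rw [vecMul_coneD_succ]
  cases i with
  | zero =>
    rw [vecMul_coneD_zero]
    have h : Matrix.vecMul z (φ 1 * G.d 0) default =
        Matrix.vecMul z (F.d 0) default := by
      rw [← hφd, ← Matrix.vecMul_vecMul, hφ0]
      simp [Matrix.vecMul, dotProduct]
    funext u
    rw [Matrix.add_vecMul, Matrix.sub_vecMul, Matrix.vecMul_vecMul, Matrix.vecMul_vecMul y, F.comp,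
      G.comp, Matrix.smul_vecMul]
    simp [h]
  | succ i =>
    rw [vecMul_coneD_succ]
    have h1 : Matrix.vecMul (Matrix.vecMul x (F.d (i + 2)) + a • z) (F.d (i + 1)) +
        a • -Matrix.vecMul z (F.prevD (i + 1)) = 0 := by
      rw [Matrix.add_vecMul, Matrix.vecMul_vecMul, F.comp, Matrix.smul_vecMul, smul_neg]
      simp [prevD]
    have h2 : Matrix.vecMul (Matrix.vecMul y (G.d (i + 2)) - Matrix.vecMul z (φ (i + 2)))
        (G.d (i + 1)) - Matrix.vecMul (-Matrix.vecMul z (F.prevD (i + 1))) (φ (i + 1)) = 0 := by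
      rw [Matrix.sub_vecMul, Matrix.vecMul_vecMul, G.comp, Matrix.vecMul_vecMul, ← hφd,
        Matrix.neg_vecMul, ← Matrix.vecMul_vecMul]
      simp [prevD]
    have h3 : -Matrix.vecMul (-Matrix.vecMul z (F.prevD (i + 1))) (F.prevD i) = 0 := by
      rw [Matrix.neg_vecMul, neg_neg, Matrix.vecMul_vecMul]
      exact (congrArg _ (F.d_mul_prevD i)).trans (Matrix.vecMul_zero _)
    refine Eq.trans (congrArg₂ Sum.elim (congrArg₂ Sum.elim h1 h2) h3) ?_
    funext t
    rcases t with (t | t) | t <;> rfl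

/-- The point is to find z' whose boundary has third component z. Subtracting that boundary from a
cycle (x, y, z) leaves a cycle of F and a cycle of G, and both are boundaries. -/
lemma coneD_exact (hφ0 : φ 0 = Matrix.of fun _ _ => 1)
    (hφd : ∀ i, F.d i * φ i = φ (i + 1) * G.d i) (ha : a ≠ 0)
    {J : Ideal (MvPolynomial V 𝕜)} (hF : F.Resolves J) (hJ : ∀ f, a * f ∈ J → f ∈ J)
    (i : ℕ) (v : coneι F G (i + 1) → MvPolynomial V 𝕜)
    (hv : Matrix.vecMul v (coneD F G a φ i) = 0) :
    ∃ w, Matrix.vecMul w (coneD F G a φ (i + 1)) = v := by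
  obtain ⟨x, y, z, rfl⟩ := exists_sum_elim v
  suffices h : ∃ z' : F.ι (i + 1) → MvPolynomial V 𝕜, -Matrix.vecMul z' (F.prevD i) = z ∧
      Matrix.vecMul (x - a • z') (F.d i) = 0 ∧
      Matrix.vecMul (y + Matrix.vecMul z' (φ (i + 1))) (G.d i) = 0 by
    obtain ⟨z', rfl, hx, hy⟩ := h
    obtain ⟨x', hx'⟩ := F.exact i _ hx
    obtain ⟨y', hy'⟩ := G.exact i _ hy
    refine ⟨(Sum.elim (Sum.elim x' y') z' : (F.ι (i + 2) ⊕ G.ι (i + 2)) ⊕ F.ι (i + 1) → _), ?_⟩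
    rw [vecMul_coneD_succ, hx', hy', sub_add_cancel, add_sub_cancel_right]
  cases i with
  | zero =>
    rw [vecMul_coneD_zero] at hv
    have hv' : Matrix.vecMul x (F.d 0) default + a * Matrix.vecMul y (G.d 0) default = 0 :=
      congrFun hv default
    -- Here a being a nonzerodivisor modulo J enters: a times this element is the image of x, hence
    -- in J.
    have hmem : -Matrix.vecMul y (G.d 0) default ∈ J := by
      refine hJ _ ?_
      rw [mul_neg, ← eq_neg_of_add_eq_zero_left hv', hF]
      exact ⟨x, funext fun u => by rw [Unique.eq_default u]⟩
    obtain ⟨z', hz'⟩ := (hF _).1 hmem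
    refine ⟨z', funext fun e => e.elim, ?_, ?_⟩
    · rw [Matrix.sub_vecMul, Matrix.smul_vecMul, hz']
      funext u
      rw [Unique.eq_default u]
      simpa [sub_neg_eq_add] using hv'
    · rw [Matrix.add_vecMul, Matrix.vecMul_vecMul, ← hφd, ← Matrix.vecMul_vecMul, hφ0, hz']
      funext u
      rw [Unique.eq_default u]
      simp [Matrix.vecMul, dotProduct]
  | succ i =>
    have hv' := (vecMul_coneD_succ (a := a) (φ := φ) i x y z).symm.trans hv
    have h1 : Matrix.vecMul x (F.d (i + 1)) + a • z = 0 :=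
      funext fun t => congrFun hv' (.inl (.inl t))
    have h2 : Matrix.vecMul y (G.d (i + 1)) - Matrix.vecMul z (φ (i + 1)) = 0 :=
      funext fun t => congrFun hv' (.inl (.inr t))
    have h3 : -Matrix.vecMul z (F.prevD i) = 0 :=
      funext fun t => congrFun hv' (.inr t)
    have hz : ∃ z' : F.ι (i + 2) → MvPolynomial V 𝕜, Matrix.vecMul z' (F.d (i + 1)) = -z := by
      refine F.exact i (-z) ?_
      cases i with
      | succ i => rw [Matrix.neg_vecMul]; exact h3
      -- The truncated differential is zero here, so `h3` carries no information. Applying `F.d 0`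
      -- to `h1` gives a · (z `F.d 0`) = 0, and a ≠ 0 in a domain.
      | zero =>
        have h0 := congrArg (fun t => Matrix.vecMul t (F.d 0)) h1
        simp only [Matrix.add_vecMul, Matrix.vecMul_vecMul, F.comp, Matrix.vecMul_zero, zero_add,
          Matrix.smul_vecMul, Matrix.zero_vecMul] at h0
        rw [Matrix.neg_vecMul, (smul_eq_zero.mp h0).resolve_left ha, neg_zero]
    obtain ⟨z', hz'⟩ := hz
    obtain rfl : z = -Matrix.vecMul z' (F.d (i + 1)) := by rw [hz', neg_neg]
    refine ⟨z', rfl, ?_, ?_⟩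
    · rw [Matrix.sub_vecMul, Matrix.smul_vecMul, sub_eq_add_neg, ← smul_neg]
      exact h1
    · rw [Matrix.add_vecMul, Matrix.vecMul_vecMul, ← hφd, ← Matrix.vecMul_vecMul]
      rw [Matrix.neg_vecMul, sub_neg_eq_add] at h2
      exact h2

/-- If `J ≤ J'`, if `J` and `J'` have linear resolutions with generators in degrees `e + 1` and
`e`, and if the linear form `a` is a nonzerodivisor modulo `J`, then `J + a J'` has a linear
resolution with generators in degree `e + 1`. -/
theorem exists_isLinear_sup {J J' : Ideal (MvPolynomial V 𝕜)} (hJJ' : J ≤ J')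
    (ha1 : a ∈ degreePart V 𝕜 1) (ha0 : a ≠ 0) (hJ : ∀ f, a * f ∈ J → f ∈ J) {e : ℤ}
    (hF : ∃ F : GradedResolution V 𝕜, F.Resolves J ∧ F.IsLinear (e + 1))
    (hG : ∃ G : GradedResolution V 𝕜, G.Resolves J' ∧ G.IsLinear e) :
    ∃ H : GradedResolution V 𝕜, H.Resolves (J ⊔ Ideal.span {a} * J') ∧ H.IsLinear (e + 1) := by
  obtain ⟨F, hF, hFl⟩ := hF
  obtain ⟨G, hG, hGl⟩ := hG
  obtain ⟨φ, hφ0, hφg, hφd⟩ := exists_chainMap F G hF hG hJJ'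
  refine ⟨{ ι := coneι F G
            deg := coneDeg F G
            deg_zero := fun _ => rfl
            d := coneD F G a φ
            graded := coneD_graded ha1 hφg
            comp := coneD_comp hφ0 hφd
            exact := coneD_exact hφ0 hφd ha0 hF hJ }, fun f => ?_, fun i k => ?_⟩
  · rw [Submodule.mem_sup]
    simp only [Ideal.mem_span_singleton_mul]
    constructor
    · rintro ⟨g, hg, _, ⟨h, hh, rfl⟩, rfl⟩
      obtain ⟨x, hx⟩ := (hF _).1 hg
      obtain ⟨y, hy⟩ := (hG _).1 hh
      exact ⟨(Sum.elim (Sum.elim x y) Empty.elim : (F.ι 1 ⊕ G.ι 1) ⊕ Empty → _),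
        (vecMul_coneD_zero x y Empty.elim).trans (by rw [hx, hy])⟩
    · rintro ⟨v, hv⟩
      obtain ⟨x, y, z, rfl⟩ := exists_sum_elim v
      have hv' := congrFun ((vecMul_coneD_zero (a := a) (φ := φ) x y z).symm.trans hv) default
      refine ⟨_, (hF _).2 ⟨x, ?_⟩, _, ⟨_, (hG _).2 ⟨y, ?_⟩, rfl⟩, hv'⟩ <;>
      · funext u
        rw [Unique.eq_default u]
  · rcases k with (k | k) | k
    · exact hFl i k
    · change G.deg (i + 1) k + 1 = _
      rw [hGl]
      ring
    · cases i with
      | zero => exact k.elim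
      | succ i =>
        change F.deg (i + 1) k + 1 = _
        rw [hFl]
        push_cast
        ring

end Cone

end GradedResolution

/-! ### Base cases: the zero ideal and the unit ideal. -/

namespace GradedResolution

variable {V 𝕜 : Type*} [Field 𝕜]

/-- The bases of a free resolution of length zero. -/
abbrev shortι (T : Type) : ℕ → Type
  | 0 => Unit
  | 1 => T
  | _ + 2 => Empty

instance (T : Type) [Fintype T] : ∀ i, Fintype (shortι T i)
  | 0 => inferInstanceAs (Fintype Unit)
  | 1 => inferInstanceAs (Fintype T)
  | _ + 2 => inferInstanceAs (Fintype Empty)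

instance (T : Type) [DecidableEq T] : ∀ i, DecidableEq (shortι T i)
  | 0 => inferInstanceAs (DecidableEq Unit)
  | 1 => inferInstanceAs (DecidableEq T)
  | _ + 2 => inferInstanceAs (DecidableEq Empty)

/-- The resolution of length zero of the zero ideal (for `T` empty) or of the unit ideal
(for `T` a singleton). -/
def short (V 𝕜 : Type*) [Field 𝕜] (T : Type) [Fintype T] [DecidableEq T] [Subsingleton T] :
    GradedResolution V 𝕜 where
  ι := shortι T
  unique := ⟨⟨()⟩, fun _ => rfl⟩
  deg _ _ := 0
  deg_zero _ := rfl
  d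
    | 0 => Matrix.of fun _ _ => 1
    | _ + 1 => 0
  graded
    | 0, _, _ => one_mem_degreePart
    | _ + 1, _, _ => Submodule.zero_mem _
  comp i := Matrix.zero_mul _
  exact
    | 0, v, hv => by
      refine ⟨0, ?_⟩
      rw [Matrix.zero_vecMul]
      funext t
      have := congrFun hv ()
      have : ∑ l : T, v l * 1 = 0 := this
      rw [Fintype.sum_subsingleton _ t, mul_one] at this
      exact this.symm
    | _ + 1, _, _ => ⟨0, funext fun k => k.elim⟩

/-- There are no basis elements above level 0, so linearity is vacuous and e is free; this fits
every degree met in the induction. -/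
lemma exists_isLinear_bot (e : ℤ) :
    ∃ F : GradedResolution V 𝕜, F.Resolves ⊥ ∧ F.IsLinear e := by
  refine ⟨short V 𝕜 Empty, fun f => ?_, fun i k => ?_⟩
  · rw [Ideal.mem_bot]
    constructor
    · rintro rfl
      exact ⟨0, Matrix.zero_vecMul _⟩
    · rintro ⟨v, hv⟩
      have h0 : v = 0 := funext fun k => Empty.elim k
      rw [h0, Matrix.zero_vecMul] at hv
      exact (congrFun hv default).symm
  · cases i <;> exact k.elim

lemma exists_isLinear_top :
    ∃ F : GradedResolution V 𝕜, F.Resolves ⊤ ∧ F.IsLinear 0 := by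
  refine ⟨short V 𝕜 Unit, fun f => ?_, fun i k => ?_⟩
  · refine iff_of_true trivial ⟨fun _ => f, funext fun u => ?_⟩
    exact (Finset.sum_singleton _ _).trans (mul_one f)
  · cases i with
    | zero => rfl
    | succ i => exact k.elim

end GradedResolution

/-! ### Products of powers of two ideals of variables. -/

section MonomialIdeal

variable {V 𝕜 : Type*} [Field 𝕜]

/-- The degree of a monomial in the variables from `A`. -/
def degOn (A : Finset V) (u : V →₀ ℕ) : ℕ := ∑ x ∈ A, u x

lemma degOn_add (A : Finset V) (u v : V →₀ ℕ) : degOn A (u + v) = degOn A u + degOn A v := by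
  simp [degOn, Finset.sum_add_distrib]

lemma degOn_single_of_mem {A : Finset V} {a : V} (ha : a ∈ A) :
    degOn A (Finsupp.single a 1) = 1 := by
  classical
  simp [degOn, Finsupp.single_apply, ha]

lemma degOn_single_of_notMem {A : Finset V} {a : V} (ha : a ∉ A) :
    degOn A (Finsupp.single a 1) = 0 := by
  classical
  simp [degOn, Finsupp.single_apply, ha]

lemma exists_coeff_ne_zero_of_mul {f g : MvPolynomial V 𝕜} {u : V →₀ ℕ}
    (h : coeff u (f * g) ≠ 0) : ∃ p q, p + q = u ∧ coeff p f ≠ 0 ∧ coeff q g ≠ 0 := by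
  classical
  rw [coeff_mul] at h
  obtain ⟨p, hp, hne⟩ := Finset.exists_ne_zero_of_sum_ne_zero h
  exact ⟨p.1, p.2, Finset.HasAntidiagonal.mem_antidiagonal.mp hp, left_ne_zero_of_mul hne,
    right_ne_zero_of_mul hne⟩

/-- The monomial ideal spanned by the monomials of degree at least `s` in the variables from `A`
and of degree at least `t` in the variables from `B`; for disjoint `A` and `B` it is the product of
powers `(A)^s (B)^t`. -/
def bidegreeIdeal (𝕜 : Type*) [Field 𝕜] (A : Finset V) (s : ℕ) (B : Finset V) (t : ℕ) :
    Ideal (MvPolynomial V 𝕜) where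
  carrier := {f | ∀ u, coeff u f ≠ 0 → s ≤ degOn A u ∧ t ≤ degOn B u}
  zero_mem' u hu := by simp at hu
  add_mem' {f g} hf hg u hu := by
    by_cases h : coeff u f = 0
    · refine hg u ?_
      rwa [coeff_add, h, zero_add] at hu
    · exact hf u h
  smul_mem' c f hf u hu := by
    obtain ⟨p, q, rfl, -, hq⟩ := exists_coeff_ne_zero_of_mul hu
    have := hf q hq
    rw [degOn_add, degOn_add]
    omega

variable {A B : Finset V} {s t : ℕ}

lemma mem_bidegreeIdeal {f : MvPolynomial V 𝕜} :
    f ∈ bidegreeIdeal 𝕜 A s B t ↔ ∀ u, coeff u f ≠ 0 → s ≤ degOn A u ∧ t ≤ degOn B u :=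
  Iff.rfl

lemma monomial_mem_bidegreeIdeal {u : V →₀ ℕ} {c : 𝕜} (hs : s ≤ degOn A u) (ht : t ≤ degOn B u) :
    monomial u c ∈ bidegreeIdeal 𝕜 A s B t := by
  classical
  intro v hv
  rw [coeff_monomial] at hv
  split_ifs at hv with h
  · exact h ▸ ⟨hs, ht⟩
  · exact (hv rfl).elim

lemma bidegreeIdeal_le {I : Ideal (MvPolynomial V 𝕜)}
    (h : ∀ u, s ≤ degOn A u → t ≤ degOn B u → monomial u 1 ∈ I) :
    bidegreeIdeal 𝕜 A s B t ≤ I := by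
  intro f hf
  rw [f.as_sum]
  refine Submodule.sum_mem _ fun u hu => ?_
  obtain ⟨h1, h2⟩ := hf u (mem_support_iff.mp hu)
  rw [← mul_one (coeff u f), ← C_mul_monomial]
  exact I.mul_mem_left _ (h u h1 h2)

lemma bidegreeIdeal_comm : bidegreeIdeal 𝕜 A s B t = bidegreeIdeal 𝕜 B t A s := by
  ext f
  simp only [mem_bidegreeIdeal, and_comm]

lemma bidegreeIdeal_zero_left (A' : Finset V) :
    bidegreeIdeal 𝕜 A 0 B t = bidegreeIdeal 𝕜 A' 0 B t := by
  ext f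
  simp [mem_bidegreeIdeal]

lemma bidegreeIdeal_zero_zero : bidegreeIdeal 𝕜 A 0 B 0 = ⊤ := by
  rw [Ideal.eq_top_iff_one]
  intro u _
  exact ⟨Nat.zero_le _, Nat.zero_le _⟩

lemma bidegreeIdeal_empty_succ : bidegreeIdeal 𝕜 ∅ (s + 1) B t = ⊥ := by
  rw [eq_bot_iff]
  refine bidegreeIdeal_le fun u hu _ => ?_
  simp [degOn] at hu

/-- The variable a is a nonzerodivisor modulo the ideal: multiplying by it shifts exponents without
changing either partial degree. -/
lemma mem_bidegreeIdeal_of_X_mul_mem {a : V} (haA : a ∉ A) (haB : a ∉ B) {f : MvPolynomial V 𝕜}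
    (hf : X a * f ∈ bidegreeIdeal 𝕜 A s B t) : f ∈ bidegreeIdeal 𝕜 A s B t := by
  intro u hu
  have := hf (Finsupp.single a 1 + u) (by rwa [coeff_X_mul])
  rwa [degOn_add, degOn_add, degOn_single_of_notMem haA, degOn_single_of_notMem haB, zero_add,
    zero_add] at this

lemma degOn_insert [DecidableEq V] {a : V} (haA : a ∉ A) (u : V →₀ ℕ) :
    degOn (insert a A) u = u a + degOn A u :=
  Finset.sum_insert haA

lemma eq_single_of_coeff_X_ne_zero {a : V} {p : V →₀ ℕ}
    (hp : coeff p (X a : MvPolynomial V 𝕜) ≠ 0) : p = Finsupp.single a 1 := by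
  classical
  rw [coeff_X] at hp
  by_contra h
  exact hp (if_neg (Ne.symm h))

lemma exists_eq_single_add {a : V} {u : V →₀ ℕ} (h : u a ≠ 0) :
    ∃ w, u = Finsupp.single a 1 + w := by
  refine ⟨u - Finsupp.single a 1, (add_tsub_cancel_of_le ?_).symm⟩
  rw [Finsupp.single_le_iff]
  omega

lemma monomial_single_add_one (a : V) (w : V →₀ ℕ) :
    monomial (Finsupp.single a 1 + w) (1 : 𝕜) = X a * monomial w 1 := by
  rw [X, monomial_mul, one_mul]

/-- Monomials are split according to whether a divides them. This is the decomposition J + aJ' fed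
to the mapping cone. -/
lemma bidegreeIdeal_insert_succ [DecidableEq V] {a : V} (haA : a ∉ A) (haB : a ∉ B) :
    bidegreeIdeal 𝕜 (insert a A) (s + 1) B t =
      bidegreeIdeal 𝕜 A (s + 1) B t ⊔ Ideal.span {X a} * bidegreeIdeal 𝕜 (insert a A) s B t := by
  apply le_antisymm
  · refine bidegreeIdeal_le fun u hs ht => ?_
    by_cases hu : u a = 0
    · rw [degOn_insert haA, hu, zero_add] at hs
      exact Ideal.mem_sup_left (monomial_mem_bidegreeIdeal hs ht)
    · obtain ⟨w, rfl⟩ := exists_eq_single_add hu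
      rw [degOn_add, degOn_single_of_mem (Finset.mem_insert_self a A)] at hs
      rw [degOn_add, degOn_single_of_notMem haB] at ht
      rw [monomial_single_add_one]
      exact Ideal.mem_sup_right (Ideal.mul_mem_mul (Ideal.mem_span_singleton_self _)
        (monomial_mem_bidegreeIdeal (by omega) (by omega)))
  · refine sup_le (fun f hf u hu => ?_) (Ideal.span_singleton_mul_le_iff.mpr fun f hf u hu => ?_)
    · have := hf u hu
      rw [degOn_insert haA]
      omega
    · obtain ⟨p, q, rfl, hp, hq⟩ := exists_coeff_ne_zero_of_mul hu
      obtain rfl := eq_single_of_coeff_X_ne_zero hp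
      have := hf q hq
      rw [degOn_add, degOn_add, degOn_single_of_mem (Finset.mem_insert_self a A)]
      omega

open GradedResolution in
-- The case without A is left as the hypothesis `h0`, so that the same induction can be run once for
-- each block.
lemma exists_isLinear_bidegreeIdeal_aux (hAB : Disjoint A B)
    (h0 : ∃ F : GradedResolution V 𝕜, F.Resolves (bidegreeIdeal 𝕜 ∅ 0 B t) ∧ F.IsLinear t) :
    ∃ F : GradedResolution V 𝕜, F.Resolves (bidegreeIdeal 𝕜 A s B t) ∧
      F.IsLinear ((s : ℤ) + t) := by
  classical
  -- The outer induction keeps s free: J involves the smaller set at s + 1, while J' involves the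
  -- same set at s and comes from the inner induction.
  induction A using Finset.induction_on generalizing s with
  | empty =>
    cases s with
    | zero => simpa using h0
    | succ s =>
      rw [bidegreeIdeal_empty_succ]
      exact exists_isLinear_bot _
  | insert a A haA ihA =>
    rw [Finset.disjoint_insert_left] at hAB
    induction s with
    | zero =>
      rw [bidegreeIdeal_zero_left ∅]
      simpa using h0
    | succ s ihs =>
      have key := ihA (s := s + 1) hAB.2
      rw [bidegreeIdeal_insert_succ haA hAB.1]
      have he : ((s + 1 : ℕ) : ℤ) + t = (s : ℤ) + t + 1 := by push_cast; ring
      rw [he] at key ⊢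
      refine exists_isLinear_sup (fun f hf u hu => ?_) (X_mem_degreePart a) (X_ne_zero a)
        (fun f => mem_bidegreeIdeal_of_X_mul_mem haA hAB.1) key ihs
      have := hf u hu
      rw [degOn_insert haA]
      omega

/-- The product of powers of ideals generated by disjoint sets of variables has a linear
resolution. -/
theorem exists_isLinear_bidegreeIdeal (hAB : Disjoint A B) :
    ∃ F : GradedResolution V 𝕜, F.Resolves (bidegreeIdeal 𝕜 A s B t) ∧
      F.IsLinear ((s : ℤ) + t) := by
  refine exists_isLinear_bidegreeIdeal_aux hAB ?_
  rw [bidegreeIdeal_comm]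
  -- The power of (B) alone is obtained with B in the first role and the empty set in the second,
  -- starting from the unit ideal.
  have := exists_isLinear_bidegreeIdeal_aux (𝕜 := 𝕜) (s := t) (t := 0)
    (Finset.disjoint_empty_right B) (by
      rw [bidegreeIdeal_zero_zero]
      exact GradedResolution.exists_isLinear_top)
  simpa using this

lemma bidegreeIdeal_mul_le (s' t' : ℕ) :
    bidegreeIdeal 𝕜 A s B t * bidegreeIdeal 𝕜 A s' B t' ≤
      bidegreeIdeal 𝕜 A (s + s') B (t + t') := by
  refine Ideal.mul_le.mpr fun f hf g hg u hu => ?_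
  obtain ⟨p, q, rfl, hp, hq⟩ := exists_coeff_ne_zero_of_mul hu
  have h1 := hf p hp
  have h2 := hg q hq
  rw [degOn_add, degOn_add]
  omega

end MonomialIdeal

/-! ### Powers of the edge ideal as monomial ideals. -/

section EdgeIdeal

lemma X_mul_X_mem_edgeIdeal (𝕜 : Type*) [Field 𝕜] {A B : Type*} (a : A) (b : B) :
    (X (.inl a) * X (.inr b) : MvPolynomial (A ⊕ B) 𝕜) ∈
      edgeIdeal 𝕜 (completeBipartiteGraph A B) :=
  Ideal.subset_span ⟨.inl a, .inr b, by simp, rfl⟩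

lemma edgeIdeal_pow_ne_bot (𝕜 : Type*) [Field 𝕜] (A B : Type*) [Nonempty A] [Nonempty B]
    (s : ℕ) :
    edgeIdeal 𝕜 (completeBipartiteGraph A B) ^ s ≠ ⊥ := by
  obtain ⟨a⟩ := ‹Nonempty A›
  obtain ⟨b⟩ := ‹Nonempty B›
  refine pow_ne_zero s fun h => ?_
  have := X_mul_X_mem_edgeIdeal 𝕜 a b
  rw [h] at this
  exact mul_ne_zero (X_ne_zero _) (X_ne_zero _) ((Ideal.mem_bot).mp this)

variable (𝕜 : Type*) [Field 𝕜] (A B : Type*) [Fintype A] [Fintype B]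

/-- The vertices of the left part. -/
def leftPart : Finset (A ⊕ B) := Finset.univ.map Function.Embedding.inl

/-- The vertices of the right part. -/
def rightPart : Finset (A ⊕ B) := Finset.univ.map Function.Embedding.inr

lemma disjoint_leftPart_rightPart : Disjoint (leftPart A B) (rightPart A B) := by
  rw [Finset.disjoint_left]
  simp [leftPart, rightPart]

lemma edgeIdeal_le_bidegreeIdeal :
    edgeIdeal 𝕜 (completeBipartiteGraph A B) ≤
      bidegreeIdeal 𝕜 (leftPart A B) 1 (rightPart A B) 1 := by
  refine Ideal.span_le.mpr ?_
  rintro _ ⟨u, v, huv, rfl⟩ w hw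
  obtain ⟨p, q, rfl, hp, hq⟩ := exists_coeff_ne_zero_of_mul hw
  obtain rfl := eq_single_of_coeff_X_ne_zero hp
  obtain rfl := eq_single_of_coeff_X_ne_zero hq
  have hl : ∀ a : A, degOn (leftPart A B) (Finsupp.single (.inl a) 1) = 1 := fun a =>
    degOn_single_of_mem (by simp [leftPart])
  have hr : ∀ b : B, degOn (rightPart A B) (Finsupp.single (.inr b) 1) = 1 := fun b =>
    degOn_single_of_mem (by simp [rightPart])
  rw [degOn_add, degOn_add]
  rcases u with a | b <;> rcases v with a' | b' <;> simp at huv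
  · rw [hl, hr]
    omega
  · rw [hl, hr]
    omega

/-- One variable is removed from each block. Any such pair is an edge, because the graph is complete
bipartite. -/
lemma monomial_mem_edgeIdeal_pow (s : ℕ) (u : A ⊕ B →₀ ℕ) (hl : s ≤ degOn (leftPart A B) u)
    (hr : s ≤ degOn (rightPart A B) u) :
    monomial u (1 : 𝕜) ∈ edgeIdeal 𝕜 (completeBipartiteGraph A B) ^ s := by
  induction s generalizing u with
  | zero => simp
  | succ s ih =>
    obtain ⟨x, hx, hxu⟩ := Finset.exists_ne_zero_of_sum_ne_zero
      (show ∑ x ∈ leftPart A B, u x ≠ 0 from fun h => by rw [degOn, h] at hl; omega)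
    obtain ⟨y, hy, hyu⟩ := Finset.exists_ne_zero_of_sum_ne_zero
      (show ∑ x ∈ rightPart A B, u x ≠ 0 from fun h => by rw [degOn, h] at hr; omega)
    have hxr := Finset.disjoint_left.mp (disjoint_leftPart_rightPart A B) hx
    have hyl := Finset.disjoint_right.mp (disjoint_leftPart_rightPart A B) hy
    obtain ⟨a, -, rfl⟩ := Finset.mem_map.mp hx
    obtain ⟨b, -, rfl⟩ := Finset.mem_map.mp hy
    simp only [Function.Embedding.inl_apply, Function.Embedding.inr_apply] at *
    obtain ⟨v, rfl⟩ := exists_eq_single_add hxu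
    obtain ⟨w, rfl⟩ := exists_eq_single_add (a := Sum.inr b) (u := v) (by simpa using hyu)
    rw [degOn_add, degOn_add, degOn_single_of_mem hx, degOn_single_of_notMem hyl] at hl
    rw [degOn_add, degOn_add, degOn_single_of_mem hy, degOn_single_of_notMem hxr] at hr
    rw [monomial_single_add_one, monomial_single_add_one, ← mul_assoc, pow_succ']
    exact Ideal.mul_mem_mul (X_mul_X_mem_edgeIdeal 𝕜 a b) (ih w (by omega) (by omega))

/-- The powers of the edge ideal of a complete bipartite graph. -/
theorem edgeIdeal_pow_eq (s : ℕ) :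
    edgeIdeal 𝕜 (completeBipartiteGraph A B) ^ s =
      bidegreeIdeal 𝕜 (leftPart A B) s (rightPart A B) s := by
  refine le_antisymm ?_ (bidegreeIdeal_le (monomial_mem_edgeIdeal_pow 𝕜 A B s))
  induction s with
  | zero => rw [bidegreeIdeal_zero_zero]; exact le_top
  | succ s ih =>
    rw [pow_succ]
    exact (Ideal.mul_mono ih (edgeIdeal_le_bidegreeIdeal 𝕜 A B)).trans (bidegreeIdeal_mul_le 1 1)

end EdgeIdeal

/-! ### Passage between the two notions of resolution, and the regularity. -/

section Conversion

variable {V 𝕜 : Type*} [Field 𝕜] {J : Ideal (MvPolynomial V 𝕜)}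

lemma vecMul_of_single {R m n : Type*} [CommRing R] [Fintype m] [DecidableEq m]
    (f : (m → R) →ₗ[R] n → R) (v : m → R) :
    Matrix.vecMul v (Matrix.of fun l k => f (Pi.single l 1) k) = f v := by
  funext k
  conv_rhs => rw [← Finset.univ_sum_single v]
  simp only [map_sum, Finset.sum_apply, Matrix.vecMul, dotProduct, Matrix.of_apply]
  refine Finset.sum_congr rfl fun l _ => ?_
  have : (Pi.single l (v l) : m → R) = v l • Pi.single l 1 := by
    rw [← Pi.single_smul, smul_eq_mul, mul_one]
  rw [this, map_smul]
  rfl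

namespace MinimalGradedFreeResolution

variable (F : MinimalGradedFreeResolution J)

/-- The bases of a minimal graded free resolution, preceded by the basis of the polynomial ring. -/
abbrev basisIndex : ℕ → Type
  | 0 => Unit
  | i + 1 => Fin (F.rank i)

instance : ∀ i, Fintype (F.basisIndex i)
  | 0 => inferInstanceAs (Fintype Unit)
  | i + 1 => inferInstanceAs (Fintype (Fin (F.rank i)))

instance : ∀ i, DecidableEq (F.basisIndex i)
  | 0 => inferInstanceAs (DecidableEq Unit)
  | i + 1 => inferInstanceAs (DecidableEq (Fin (F.rank i)))

/-- The matrices of the augmentation and of the differentials. -/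
def toMatrix : ∀ i, Matrix (F.basisIndex (i + 1)) (F.basisIndex i) (MvPolynomial V 𝕜)
  | 0 => Matrix.of fun l k => (LinearMap.pi fun _ : Unit => F.aug) (Pi.single l 1) k
  | i + 1 => Matrix.of fun l k => F.diff i (Pi.single l 1) k

lemma vecMul_toMatrix_zero (v : Fin (F.rank 0) → MvPolynomial V 𝕜) :
    Matrix.vecMul v (F.toMatrix 0) = fun _ => F.aug v :=
  vecMul_of_single (LinearMap.pi fun _ : Unit => F.aug) v

lemma vecMul_toMatrix_succ (i : ℕ) (v : Fin (F.rank (i + 1)) → MvPolynomial V 𝕜) :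
    Matrix.vecMul v (F.toMatrix (i + 1)) = F.diff i v :=
  vecMul_of_single (F.diff i) v

/-- The matrix form of a minimal graded free resolution. -/
def toGradedResolution : GradedResolution V 𝕜 where
  ι := F.basisIndex
  unique := ⟨⟨()⟩, fun _ => rfl⟩
  deg
    | 0 => fun _ => 0
    | i + 1 => F.shift i
  deg_zero _ := rfl
  d := F.toMatrix
  graded
    | 0, l, _ => by
      rw [sub_zero]
      exact F.aug_graded l
    | i + 1, l, k => F.diff_graded i l k
  comp i := by
    refine GradedResolution.mul_eq_zero_of_vecMul fun v => ?_
    rw [vecMul_toMatrix_succ]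
    cases i with
    | zero =>
      rw [vecMul_toMatrix_zero, F.exact_zero.apply_apply_eq_zero]
      rfl
    | succ i =>
      rw [vecMul_toMatrix_succ, (F.exact_succ i).apply_apply_eq_zero]
  exact i v hv := by
    suffices h : ∃ w, F.diff i w = v from
      h.imp fun w hw => (F.vecMul_toMatrix_succ i w).trans hw
    cases i with
    | zero =>
      rw [vecMul_toMatrix_zero] at hv
      exact (F.exact_zero v).mp (congrFun hv ())
    | succ i =>
      rw [vecMul_toMatrix_succ] at hv
      exact (F.exact_succ i v).mp hv

lemma resolves_toGradedResolution : F.toGradedResolution.Resolves J := by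
  intro f
  conv_lhs => rw [← F.range_aug]
  refine exists_congr fun v => ?_
  change _ ↔ Matrix.vecMul v (F.toMatrix 0) = _
  rw [vecMul_toMatrix_zero]
  exact ⟨fun h => funext fun _ => h, fun h => congrFun h ()⟩

theorem shift_le {G : GradedResolution V 𝕜} (hG : G.Resolves J) {e : ℤ} (hlin : G.IsLinear e)
    (i : ℕ) (k : Fin (F.rank i)) : F.shift i k ≤ e + i := by
  refine GradedResolution.deg_le_of_isLinear hG F.resolves_toGradedResolution hlin ?_ i k
  intro i l k
  have h : Ideal.span (Set.range (X : V → MvPolynomial V 𝕜)) ≤ RingHom.ker constantCoeff := by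
    refine Ideal.span_le.mpr ?_
    rintro _ ⟨a, rfl⟩
    simp
  exact h (F.minimal i l k)

end MinimalGradedFreeResolution

lemma single_comp_equiv {R m n : Type*} [Zero R] [DecidableEq m] [DecidableEq n] (e : m ≃ n)
    (l : n) (r : R) : (Pi.single l r : n → R) ∘ e = Pi.single (e.symm l) r := by
  funext k
  simp [Pi.single_apply, e.eq_symm_apply]

namespace GradedResolution

variable (F : GradedResolution V 𝕜)

/-- An enumeration of the basis at level `i + 1`. -/
def enum (i : ℕ) : F.ι (i + 1) ≃ Fin (Fintype.card (F.ι (i + 1))) :=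
  Fintype.equivFin _

/-- The augmentation with respect to the enumerated bases. -/
def finAug : (Fin (Fintype.card (F.ι 1)) → MvPolynomial V 𝕜) →ₗ[MvPolynomial V 𝕜]
    MvPolynomial V 𝕜 :=
  LinearMap.proj default ∘ₗ (F.d 0).vecMulLinear ∘ₗ
    (LinearEquiv.funCongrLeft (MvPolynomial V 𝕜) (MvPolynomial V 𝕜) (F.enum 0)).toLinearMap

/-- The differential with respect to the enumerated bases. -/
def finDiff (i : ℕ) : (Fin (Fintype.card (F.ι (i + 2))) → MvPolynomial V 𝕜) →ₗ[MvPolynomial V 𝕜]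
    (Fin (Fintype.card (F.ι (i + 1))) → MvPolynomial V 𝕜) :=
  (LinearEquiv.funCongrLeft (MvPolynomial V 𝕜) (MvPolynomial V 𝕜) (F.enum i).symm).toLinearMap ∘ₗ
    (F.d (i + 1)).vecMulLinear ∘ₗ
    (LinearEquiv.funCongrLeft (MvPolynomial V 𝕜) (MvPolynomial V 𝕜) (F.enum (i + 1))).toLinearMap

lemma finAug_apply (v) : F.finAug v = Matrix.vecMul (v ∘ F.enum 0) (F.d 0) default := rfl

lemma finDiff_apply (i : ℕ) (v) :
    F.finDiff i v = Matrix.vecMul (v ∘ F.enum (i + 1)) (F.d (i + 1)) ∘ (F.enum i).symm := rfl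

lemma finDiff_comp_enum (i : ℕ) (v) :
    F.finDiff i v ∘ F.enum i = Matrix.vecMul (v ∘ F.enum (i + 1)) (F.d (i + 1)) := by
  rw [finDiff_apply, Function.comp_assoc, Equiv.symm_comp_self, Function.comp_id]

lemma finDiff_single (i : ℕ) (l k) :
    F.finDiff i (Pi.single l 1) k = F.d (i + 1) ((F.enum (i + 1)).symm l) ((F.enum i).symm k) := by
  rw [finDiff_apply, single_comp_equiv, Matrix.single_one_vecMul]
  rfl

lemma exists_finDiff_eq (i : ℕ) {v} (hv : Matrix.vecMul (v ∘ F.enum i) (F.d i) = 0) :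
    ∃ w, F.finDiff i w = v := by
  obtain ⟨w, hw⟩ := F.exact i _ hv
  refine ⟨w ∘ (F.enum (i + 1)).symm, ?_⟩
  rw [finDiff_apply, Function.comp_assoc, Equiv.symm_comp_self, Function.comp_id, hw,
    Function.comp_assoc, Equiv.self_comp_symm, Function.comp_id]

lemma vecMul_finDiff (i : ℕ) (w) : Matrix.vecMul (F.finDiff i w ∘ F.enum i) (F.d i) = 0 := by
  rw [finDiff_comp_enum, Matrix.vecMul_vecMul, F.comp, Matrix.vecMul_zero]

/-- A linear resolution in matrix form is a minimal graded free resolution. -/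
def toMinimal (hF : F.Resolves J) {e : ℤ} (hlin : F.IsLinear e) :
    MinimalGradedFreeResolution J where
  rank i := Fintype.card (F.ι (i + 1))
  shift i k := F.deg (i + 1) ((F.enum i).symm k)
  aug := F.finAug
  diff := F.finDiff
  aug_graded k := by
    rw [finAug_apply, single_comp_equiv, Matrix.single_one_vecMul]
    have := F.graded 0 ((F.enum 0).symm k) default
    rwa [F.deg_zero, sub_zero] at this
  diff_graded i l k := by
    rw [finDiff_single]
    exact F.graded (i + 1) _ _
  range_aug := by
    ext f
    rw [hF, LinearMap.mem_range]
    constructor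
    · rintro ⟨v, rfl⟩
      exact ⟨v ∘ F.enum 0, funext fun u => by rw [Unique.eq_default u]; rfl⟩
    · rintro ⟨v, hv⟩
      refine ⟨v ∘ (F.enum 0).symm, ?_⟩
      rw [finAug_apply, Function.comp_assoc, Equiv.symm_comp_self, Function.comp_id, hv]
  exact_zero v := by
    constructor
    · intro hv
      exact F.exists_finDiff_eq 0 (funext fun u => by rw [Unique.eq_default u]; exact hv)
    · rintro ⟨w, rfl⟩
      exact congrFun (F.vecMul_finDiff 0 w) default
  exact_succ i v := by
    constructor
    · intro hv
      refine F.exists_finDiff_eq (i + 1) ?_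
      rw [← finDiff_comp_enum, hv]
      rfl
    · rintro ⟨w, rfl⟩
      rw [finDiff_apply, vecMul_finDiff]
      rfl
  minimal i l k := by
    rw [finDiff_single]
    have h := F.graded (i + 1) ((F.enum (i + 1)).symm l) ((F.enum i).symm k)
    -- Linearity forces minimality: the entries have degree (e + i + 1) - (e + i) = 1, so they have
    -- no constant term.
    rw [hlin, hlin, mem_degreePart_iff] at h
    rw [← Set.image_univ, mem_ideal_span_X_image]
    intro u hu
    have hu' := h u (mem_support_iff.mp hu)
    by_contra! hz
    have : u = 0 := Finsupp.ext fun a => hz a trivial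
    rw [this] at hu'
    push_cast at hu'
    simp at hu'

/-- The regularity of a nonzero ideal with a linear resolution is the degree of its generators. -/
theorem regularity_eq (hF : F.Resolves J) {e : ℤ} (hlin : F.IsLinear e) (hJ : J ≠ ⊥) :
    regularity J = ((e : WithTop ℤ) : WithBot (WithTop ℤ)) := by
  apply le_antisymm
  · refine iSup_le fun G => iSup_le fun i => iSup_le fun k => ?_
    rw [WithBot.coe_le_coe, WithTop.coe_le_coe]
    have := G.shift_le hF hlin i k
    omega
  -- Attaining the bound requires a generator; without one the image of `F.d 0`, which is J, would
  -- be zero.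
  · have hne : Nonempty (F.ι 1) := by
      by_contra hempty
      rw [not_nonempty_iff] at hempty
      refine hJ ((Submodule.eq_bot_iff J).mpr fun f hf => ?_)
      obtain ⟨v, hv⟩ := (hF f).1 hf
      exact (congrFun hv default).symm.trans (Finset.sum_of_isEmpty (ι := F.ι 1) _)
    obtain ⟨x⟩ := hne
    refine le_iSup_of_le (F.toMinimal hF hlin) (le_iSup_of_le 0 (le_iSup_of_le (F.enum 0 x) ?_))
    rw [WithBot.coe_le_coe, WithTop.coe_le_coe]
    change e ≤ F.deg 1 _ - _
    rw [hlin]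
    simp

lemma hasLinearResolution (hF : F.Resolves J) {e : ℤ} (hlin : F.IsLinear e) :
    HasLinearResolution J e :=
  ⟨F.toMinimal hF hlin, fun i _ => hlin i _⟩

end GradedResolution

end Conversion

end EdgeIdealPowers

end

theorem mainTheorem7 (𝕜 : Type*) [Field 𝕜] (A B : Type*) [Finite A] [Finite B]
    [Nonempty A] [Nonempty B] (s : ℕ) (hs : 1 ≤ s) :
    EdgeIdealPowers.regularity (EdgeIdealPowers.edgeIdeal 𝕜 (completeBipartiteGraph A B) ^ s) =
        (((2 * (s : ℤ) : ℤ) : WithTop ℤ) : WithBot (WithTop ℤ)) ∧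
      EdgeIdealPowers.HasLinearResolution
        (EdgeIdealPowers.edgeIdeal 𝕜 (completeBipartiteGraph A B) ^ s) (2 * (s : ℤ)) := by
  have := Fintype.ofFinite A
  have := Fintype.ofFinite B
  obtain ⟨F, hF, hlin⟩ := EdgeIdealPowers.exists_isLinear_bidegreeIdeal (𝕜 := 𝕜) (s := s) (t := s)
    (EdgeIdealPowers.disjoint_leftPart_rightPart A B)
  rw [← EdgeIdealPowers.edgeIdeal_pow_eq] at hF
  rw [← two_mul] at hlin
  exact ⟨F.regularity_eq hF hlin (EdgeIdealPowers.edgeIdeal_pow_ne_bot 𝕜 A B s),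
    F.hasLinearResolution hF hlin⟩
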